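/- Let $m,n$ be coprime and write $[m]=\{0,\dots,m-1\}$. An $(m,n)$-parking function is a word $p=p_{n-1}\cdots p_1p_0\in[m]^n$ with $\#\{j: p_j<i\}\ge in/m$ for $1\le i\le m$. Let $V^m=\{x\in\mathbb R^m:\sum_i x_i=0,\ x_0\le\dots\le x_{m-1}\}$. A letter $i\in[m]$ acts on $V^m$ by adding $m$ to the $i$-th coordinate, subtracting $1$ from every coordinate, and sorting the coordinates into increasing order; a word acts one letter at a time from right to left ($p_0$ first). An alcove is the closure of a connected component of the complement, in $W=\{x\in\mathbb R^m:\sum_i x_i=0\}$, of the hyperplanes $x_i-x_j=km$ ($0\le i<j\le m-1$, $k\in\mathbb Z$). The centroid of an alcove is the unique point $x$ of its interior (relative to $W$) such that all the numbers $\frac{m+1}{2}-x_i$ are integers. **Theorem.** Let $\gcd(m,n)=1$ and let $p$ be an $(m,n)$-parking function. Then $p$ has exactly one fixed point $x_p$ in $V^m$, exactly one alcove $A_p$ contains $x_p$, and $x_p$ is the centroid of $A_p$. The points of $V^m$ that are periodic but not fixed under $p$ are exactly the points of $A_p\setminus\{x_p\}$. Each of them has period $m$, in the sense that $p^m\cdot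 x=x$ (so its least period divides $m$ and is greater than $1$), and the points whose least period equals $m$ are dense in $A_p$. Every orbit eventually becomes periodic with period dividing $m$: for every $x\in V^m$ there is $k\ge 0$ with $p^{k+m}\cdot x=p^k\cdot x$. -/

import Mathlib

open Set Topology

/-- The hyperplane `∑ i, x i = 0` of `ℝ^m`, the ambient space of the affine braid arrangement. -/
def zeroSum (m : ℕ) : Set (Fin m → ℝ) := {x | ∑ i, x i = 0}

/-- The Weyl chamber `V^m`: the weakly increasing vectors of `ℝ^m` with coordinate sum zero. -/
def weylChamber (m : ℕ) : Set (Fin m → ℝ) := {x | ∑ i, x i = 0 ∧ Monotone x}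

/-- An `(m, n)`-parking function: a word `w_{n-1} ⋯ w_0` in the letters `0, …, m - 1` such that
`#{j : w_j < i} ≥ i n / m` for `1 ≤ i ≤ m`. The letter `w_j` is `w j`. -/
def IsParkingFunction (m n : ℕ) (w : Fin n → Fin m) : Prop :=
  ∀ i : ℕ, 1 ≤ i → i ≤ m →
    ((i : ℚ) * (n : ℚ)) / (m : ℚ) ≤ ((Finset.univ.filter (fun j => (w j : ℕ) < i)).card : ℚ)

/-- Add `m` to coordinate `i`, and subtract `1` from every coordinate. -/
def letterShift {m : ℕ} (i : Fin m) (x : Fin m → ℝ) : Fin m → ℝ :=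
  fun j => x j + (if j = i then (m : ℝ) else 0) - 1

/-- The action of the letter `i`: shift, then sort the coordinates into increasing order. -/
noncomputable def letterAct {m : ℕ} (i : Fin m) (x : Fin m → ℝ) : Fin m → ℝ :=
  letterShift i x ∘ Tuple.sort (letterShift i x)

/-- The action of a word `w_{n-1} ⋯ w_0`, one letter at a time from right to left: `w 0` acts
first and `w (n - 1)` acts last. -/
noncomputable def wordAct {m n : ℕ} (w : Fin n → Fin m) (x : Fin m → ℝ) : Fin m → ℝ :=
  (List.ofFn w).foldl (fun y i => letterAct i y) x

theorem letterAct_mem_weylChamber {m : ℕ} (i : Fin m) {x : Fin m → ℝ}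
    (hx : x ∈ weylChamber m) : letterAct i x ∈ weylChamber m := by
  refine ⟨?_, Tuple.monotone_sort _⟩
  have h : ∑ j, letterAct i x j = ∑ j, letterShift i x j :=
    Equiv.sum_comp (Tuple.sort (letterShift i x)) (letterShift i x)
  rw [h]
  simp [letterShift, Finset.sum_add_distrib, hx.1]

/-- Words act on the Weyl chamber. -/
theorem wordAct_mem_weylChamber {m n : ℕ} (w : Fin n → Fin m) {x : Fin m → ℝ}
    (hx : x ∈ weylChamber m) : wordAct w x ∈ weylChamber m := by
  unfold wordAct
  generalize List.ofFn w = l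
  induction l generalizing x with
  | nil => exact hx
  | cons i l ih => exact ih (letterAct_mem_weylChamber i hx)

/-- The hyperplane `x_i - x_j = k m` inside the space of vectors with coordinate sum zero. -/
def braidHyperplane (m : ℕ) (i j : Fin m) (k : ℤ) : Set (Fin m → ℝ) :=
  {x ∈ zeroSum m | x i - x j = (k : ℝ) * (m : ℝ)}

/-- The complement of the affine braid arrangement `{x_i - x_j = k m : i < j, k ∈ ℤ}`. -/
def braidComplement (m : ℕ) : Set (Fin m → ℝ) :=
  zeroSum m \ ⋃ (i : Fin m) (j : Fin m) (_ : i < j) (k : ℤ), braidHyperplane m i j k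

/-- An alcove: the closure of a connected component of the complement of the arrangement. -/
def IsAlcove (m : ℕ) (A : Set (Fin m → ℝ)) : Prop :=
  ∃ x ∈ braidComplement m, A = closure (connectedComponentIn (braidComplement m) x)

/-- `x` lies in the interior of `A` relative to the space of vectors with coordinate sum zero,
and every `(m + 1) / 2 - x_i` is an integer. -/
def IsCentralPoint (m : ℕ) (A : Set (Fin m → ℝ)) (x : Fin m → ℝ) : Prop :=
  x ∈ zeroSum m ∧ A ∈ 𝓝[zeroSum m] x ∧ ∀ i, ∃ z : ℤ, ((m : ℝ) + 1) / 2 - x i = (z : ℝ)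

/-- `x` is the centroid of the alcove `A`: the unique point in its interior for which all the
numbers `(m + 1) / 2 - x_i` are integers. (For the arrangement `x_i - x_j = k`, which is this one
scaled by `1 / m`, these numbers read `(m + 1) / 2 - m x_i`.) -/
def IsAlcoveCentroid (m : ℕ) (A : Set (Fin m → ℝ)) (x : Fin m → ℝ) : Prop :=
  IsCentralPoint m A x ∧ ∀ y, IsCentralPoint m A y → y = x

/-!
Regard the coordinates of a vector as labelled particles on a line. A letter moves one particle by
`m` relative to the others and then re-ranks all of them; `MovesWith a x y` says that the particles
of `x` and `y` are moved and re-ranked alike at all times.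

*A fixed point exists.* One pass of a parking function increases the squared norm by at most a
constant minus twice the distance from the lowest to the highest coordinate, by summing the
parking inequalities by parts (`IsParkingFunction.sum_le`; coprimality makes them strict). So orbits
are bounded, and since `m` passes preserve the coordinates modulo `m`, they are eventually periodic
(`IsParkingFunction.exists_mem_periodicPts`). Sorting does not increase Euclidean distances, and
preserves the distance of two vectors only if they are ordered alike (`sqDist_sort`). Hence on a
periodic orbit each letter finds all points ordered alike, acts on them by one affine map, and the
mean of the orbit is a fixed point (`exists_fixedPoint`).

*Its alcove.* Let `x` be a fixed point. Each pass changes the positions by `-n` modulo `m`, so by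
coprimality every particle visits every rank (`particleRank_bijective`). Consequently the
coordinates of `x` represent each residue modulo `m` once, up to a common shift, and any two
particles change their order at some time. When they do, they are at most `m` apart, both for `x`
and for every `y` that moves with `x` (`exists_common_strip`). A periodic `y` does move with `x`, by
the rigidity of distances again, so it lies in the alcove of `x` (`mem_closedCell_of_movesWith`).
Conversely the points `y` of this alcove move with `x` (`movesWith_of_mem_closedCell`), so they
return after `m` passes; in between, the coordinates of `y - x` are permuted by the powers of an
`m`-cycle, which gives uniqueness of the fixed point (`eq_of_fixed`) and least period `m` whenever
these coordinates are distinct (`period_of_sub_injective`).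

*Topology.* Components of the complement of the arrangement are the open cells `openCell`, and the
alcoves are their closures `closedCell`.
-/

/-! ### Sorting is a nonexpansive map -/

/-- The squared Euclidean distance (functions on `Fin m` carry the sup distance in Mathlib). -/
def sqDist {m : ℕ} (x y : Fin m → ℝ) : ℝ := ∑ i, (x i - y i) ^ 2

theorem sqDist_eq {m : ℕ} (x y : Fin m → ℝ) :
    sqDist x y = ∑ i, x i ^ 2 + ∑ i, y i ^ 2 - 2 * ∑ i, x i * y i := by
  unfold sqDist
  rw [Finset.mul_sum, ← Finset.sum_add_distrib, ← Finset.sum_sub_distrib]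
  exact Finset.sum_congr rfl fun i _ => by ring

/-- Sorting does not increase distances, by the rearrangement inequality, and it preserves the
distance of two vectors only if they are ordered alike. -/
theorem sqDist_sort {m : ℕ} (u v : Fin m → ℝ) :
    sqDist (u ∘ Tuple.sort u) (v ∘ Tuple.sort v) ≤ sqDist u v ∧
    (sqDist (u ∘ Tuple.sort u) (v ∘ Tuple.sort v) = sqDist u v → Monovary u v) := by
  have hmono : Monovary (u ∘ Tuple.sort u) (v ∘ Tuple.sort v) :=
    (Tuple.monotone_sort u).monovary (Tuple.monotone_sort v)
  set σ : Equiv.Perm (Fin m) := (Tuple.sort v)⁻¹ * Tuple.sort u with hσ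
  have hcomp : (v ∘ Tuple.sort v) ∘ σ = v ∘ Tuple.sort u := by
    funext i; simp [hσ]
  have hsum : ∑ i, (u ∘ Tuple.sort u) i * (v ∘ Tuple.sort v) (σ i) = ∑ i, u i * v i := by
    rw [← Equiv.sum_comp (Tuple.sort u) (fun i => u i * v i)]
    exact Finset.sum_congr rfl fun i _ => congrArg (u (Tuple.sort u i) * ·) (congrFun hcomp i)
  have hu : ∑ i, (u ∘ Tuple.sort u) i ^ 2 = ∑ i, u i ^ 2 :=
    Equiv.sum_comp (Tuple.sort u) (fun i => u i ^ 2)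
  have hv : ∑ i, (v ∘ Tuple.sort v) i ^ 2 = ∑ i, v i ^ 2 :=
    Equiv.sum_comp (Tuple.sort v) (fun i => v i ^ 2)
  have hle := hmono.sum_mul_comp_perm_le_sum_mul (σ := σ)
  rw [sqDist_eq, sqDist_eq, hu, hv]
  refine ⟨by linarith, fun h => ?_⟩
  have h2 := (hmono.sum_mul_comp_perm_eq_sum_mul_iff (σ := σ)).1 (by linarith)
  rw [hcomp] at h2
  intro i j hij
  have := @h2 ((Tuple.sort u)⁻¹ i) ((Tuple.sort u)⁻¹ j) (by simpa using hij)
  simpa using this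

theorem comp_sort_eq {m : ℕ} {f : Fin m → ℝ} (σ : Equiv.Perm (Fin m)) (h : Monotone (f ∘ σ)) :
    f ∘ Tuple.sort f = f ∘ σ :=
  (Tuple.comp_sort_eq_comp_iff_monotone.2 h).symm

theorem Monovary.monotone_comp_sort {m : ℕ} {u v : Fin m → ℝ} (h : Monovary u v)
    (hu : Function.Injective u) : Monotone (v ∘ Tuple.sort u) := by
  have hs : StrictMono (u ∘ Tuple.sort u) :=
    (Tuple.monotone_sort u).strictMono_of_injective (hu.comp (Tuple.sort u).injective)
  intro i j hij
  rcases hij.eq_or_lt with rfl | hlt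
  · exact le_rfl
  · exact h.symm (hs hlt)

/-- If finitely many vectors are pairwise ordered alike, a permutation sorting their sum sorts
each of them: where the sum is tied, every summand is. -/
theorem monotone_comp_sort_of_sum {m N : ℕ} {u : Fin N → Fin m → ℝ}
    (h : ∀ i j, Monovary (u i) (u j)) (i : Fin N) :
    Monotone (u i ∘ Tuple.sort (fun k => ∑ j, u j k)) := by
  intro k l hkl
  have h1 := Tuple.monotone_sort (fun k => ∑ j, u j k) hkl
  simp only [Function.comp_apply] at h1 ⊢
  by_contra! hlt
  have h2 : ∑ j, u j (Tuple.sort (fun k => ∑ j, u j k) l) <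
      ∑ j, u j (Tuple.sort (fun k => ∑ j, u j k) k) :=
    Finset.sum_lt_sum (fun j _ => h j i hlt) ⟨i, Finset.mem_univ _, hlt⟩
  exact absurd h1 (not_le.2 h2)

theorem sqDist_letterShift {m : ℕ} (a : Fin m) (x y : Fin m → ℝ) :
    sqDist (letterShift a x) (letterShift a y) = sqDist x y :=
  Finset.sum_congr rfl fun i _ => by simp only [letterShift]; ring

theorem sqDist_letterAct_le {m : ℕ} (a : Fin m) (x y : Fin m → ℝ) :
    sqDist (letterAct a x) (letterAct a y) ≤ sqDist x y :=
  (sqDist_sort _ _).1.trans_eq (sqDist_letterShift a x y)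

theorem monovary_of_sqDist_letterAct {m : ℕ} {a : Fin m} {x y : Fin m → ℝ}
    (h : sqDist (letterAct a x) (letterAct a y) = sqDist x y) :
    Monovary (letterShift a x) (letterShift a y) :=
  (sqDist_sort _ _).2 (h.trans (sqDist_letterShift a x y).symm)

/-! ### Trajectories and particles -/

/-- The point reached from `x` after the first `t` letters of the infinite word `a`. -/
noncomputable def wordOrbit {m : ℕ} (a : ℕ → Fin m) (x : Fin m → ℝ) : ℕ → Fin m → ℝ
  | 0 => x
  | t + 1 => letterAct (a t) (wordOrbit a x t)

/-- Regard the coordinates of `x` as labelled particles on a line, which keep their labels while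
they are moved and sorted: `particleRank a x t k` is the index, in the sorted vector reached after
`t` letters, of the particle that started as the `k`-th coordinate. -/
noncomputable def particleRank {m : ℕ} (a : ℕ → Fin m) (x : Fin m → ℝ) :
    ℕ → Equiv.Perm (Fin m)
  | 0 => 1
  | t + 1 => (Tuple.sort (letterShift (a t) (wordOrbit a x t)))⁻¹ * particleRank a x t

/-- How many of the first `t` letters have added `m` to the particle `k`. -/
noncomputable def hits {m : ℕ} (a : ℕ → Fin m) (x : Fin m → ℝ) (t : ℕ) (k : Fin m) : ℤ :=
  ∑ s ∈ Finset.range t, if particleRank a x s k = a s then 1 else 0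

/-- The particles of `y` move in step with those of `x`: at all times they are ranked and shifted
alike. -/
def MovesWith {m : ℕ} (a : ℕ → Fin m) (x y : Fin m → ℝ) : Prop :=
  ∀ t k, wordOrbit a y t (particleRank a x t k) = y k + m * hits a x t k - t

theorem hits_succ {m : ℕ} (a : ℕ → Fin m) (x : Fin m → ℝ) (t : ℕ) (k : Fin m) :
    hits a x (t + 1) k = hits a x t k + if particleRank a x t k = a t then 1 else 0 :=
  Finset.sum_range_succ _ _

theorem sort_particleRank_succ {m : ℕ} (a : ℕ → Fin m) (x : Fin m → ℝ) (t : ℕ) (k : Fin m) :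
    Tuple.sort (letterShift (a t) (wordOrbit a x t)) (particleRank a x (t + 1) k) =
      particleRank a x t k := by
  simp [particleRank]

theorem letterShift_particleRank {m : ℕ} {a : ℕ → Fin m} {x y : Fin m → ℝ} {t : ℕ} {k : Fin m}
    (h : wordOrbit a y t (particleRank a x t k) = y k + m * hits a x t k - t) :
    letterShift (a t) (wordOrbit a y t) (particleRank a x t k) =
      y k + m * hits a x (t + 1) k - (t + 1 : ℕ) := by
  rw [letterShift, h, hits_succ]
  push_cast
  split_ifs <;> ring

/-- It is enough that the permutations which sort the trajectory of `x` also sort that of `y`,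
granted at each time that the particles have moved in step until then. -/
theorem movesWith_of_monotone {m : ℕ} {a : ℕ → Fin m} {x y : Fin m → ℝ}
    (h : ∀ t, (∀ k, wordOrbit a y t (particleRank a x t k) = y k + m * hits a x t k - t) →
      Monotone (letterShift (a t) (wordOrbit a y t) ∘
        Tuple.sort (letterShift (a t) (wordOrbit a x t)))) :
    MovesWith a x y := by
  intro t
  induction t with
  | zero => intro k; simp [wordOrbit, particleRank, hits]
  | succ t ih =>
    intro k
    have h1 : wordOrbit a y (t + 1) = letterShift (a t) (wordOrbit a y t) ∘
        Tuple.sort (letterShift (a t) (wordOrbit a x t)) := comp_sort_eq _ (h t ih)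
    rw [h1, Function.comp_apply, sort_particleRank_succ, letterShift_particleRank (ih k)]

theorem movesWith_self {m : ℕ} (a : ℕ → Fin m) (x : Fin m → ℝ) : MovesWith a x x :=
  movesWith_of_monotone fun _ _ => Tuple.monotone_sort _

theorem wordOrbit_mem_weylChamber {m : ℕ} (a : ℕ → Fin m) {x : Fin m → ℝ}
    (hx : x ∈ weylChamber m) (t : ℕ) : wordOrbit a x t ∈ weylChamber m := by
  induction t with
  | zero => exact hx
  | succ t ih => exact letterAct_mem_weylChamber _ ih

theorem sqDist_wordOrbit_antitone {m : ℕ} (a : ℕ → Fin m) (x y : Fin m → ℝ) :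
    Antitone fun t => sqDist (wordOrbit a x t) (wordOrbit a y t) :=
  antitone_nat_of_succ_le fun _ => sqDist_letterAct_le _ _ _

/-- Two recurrent trajectories keep their distance, so that each letter finds them ordered alike. -/
theorem monovary_of_recurrent {m : ℕ} {a : ℕ → Fin m} {x y : Fin m → ℝ}
    (h : ∀ t, ∃ s, t < s ∧ wordOrbit a x s = x ∧ wordOrbit a y s = y) (t : ℕ) :
    Monovary (letterShift (a t) (wordOrbit a x t)) (letterShift (a t) (wordOrbit a y t)) := by
  obtain ⟨s, hs, hxs, hys⟩ := h t
  have hanti := sqDist_wordOrbit_antitone a x y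
  have h1 : sqDist (wordOrbit a x (t + 1)) (wordOrbit a y (t + 1)) ≤
    sqDist (wordOrbit a x t) (wordOrbit a y t) := hanti t.le_succ
  have h2 : sqDist (wordOrbit a x t) (wordOrbit a y t) ≤ sqDist x y := hanti t.zero_le
  have h3 : sqDist (wordOrbit a x s) (wordOrbit a y s) ≤
    sqDist (wordOrbit a x (t + 1)) (wordOrbit a y (t + 1)) := hanti hs
  rw [hxs, hys] at h3
  exact monovary_of_sqDist_letterAct (le_antisymm h1 (h2.trans h3))

/-- `a` is the infinite word `⋯ w w w`, read from right to left. -/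
def IsRepetition {m n : ℕ} (w : Fin n → Fin m) (a : ℕ → Fin m) : Prop :=
  ∀ (j : ℕ) (i : Fin n), a (j * n + i) = w i

theorem exists_isRepetition {m n : ℕ} (w : Fin n → Fin m) (hm : 0 < m) :
    ∃ a, IsRepetition w a := by
  rcases Nat.eq_zero_or_pos n with rfl | hn
  · exact ⟨fun _ => ⟨0, hm⟩, fun _ i => i.elim0⟩
  · refine ⟨fun t => w ⟨t % n, Nat.mod_lt _ hn⟩, fun j i => ?_⟩
    exact congrArg w (Fin.ext (by simp [Nat.mod_eq_of_lt i.2]))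

theorem wordAct_wordOrbit {m : ℕ} (a : ℕ → Fin m) (x : Fin m → ℝ) {n : ℕ} (w : Fin n → Fin m)
    (s : ℕ) (h : ∀ i : Fin n, a (s + i) = w i) :
    wordAct w (wordOrbit a x s) = wordOrbit a x (s + n) := by
  unfold wordAct
  induction n generalizing s with
  | zero => simp
  | succ n ih =>
    rw [List.ofFn_succ, List.foldl_cons]
    have h0 : letterAct (w 0) (wordOrbit a x s) = wordOrbit a x (s + 1) := by
      rw [← h 0]; rfl
    rw [h0, ih (fun i => w i.succ) (s + 1) fun i => by
      rw [← h i.succ, Fin.val_succ, add_assoc, add_comm 1], add_assoc, add_comm 1]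

theorem IsRepetition.iterate {m n : ℕ} {w : Fin n → Fin m} {a : ℕ → Fin m}
    (h : IsRepetition w a) (x : Fin m → ℝ) (j : ℕ) :
    (wordAct w)^[j] x = wordOrbit a x (j * n) := by
  induction j with
  | zero => simp [wordOrbit]
  | succ j ih =>
    rw [Function.iterate_succ_apply', ih, wordAct_wordOrbit a x w _ (h j), Nat.succ_mul]

/-! ### Particles of a fixed point -/

/-- The coordinates of `x` differ by integers, and represent every residue modulo `m` once. -/
structure HasDistinctResidues {m : ℕ} (x : Fin m → ℝ) : Prop where
  exists_int : ∀ k l, ∃ z : ℤ, x l - x k = z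
  eq_of_sub : ∀ k l (c : ℤ), x l - x k = c * m → k = l
  exists_succ : ∀ k, ∃ l, ∃ c : ℤ, x l = x k + 1 + c * m

theorem HasDistinctResidues.injective {m : ℕ} {x : Fin m → ℝ} (h : HasDistinctResidues x) :
    Function.Injective x := fun k l hkl => h.eq_of_sub k l 0 (by simp [hkl])

section FixedPoint

variable {m n : ℕ} {a : ℕ → Fin m} {x y : Fin m → ℝ}

theorem apply_particleRank (h : MovesWith a x y) {j : ℕ} (hy : wordOrbit a y (j * n) = y)
    (k : Fin m) :
    y (particleRank a x (j * n) k) = y k + m * hits a x (j * n) k - j * n := by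
  have := h (j * n) k
  rw [hy] at this
  exact_mod_cast this

theorem particleRank_injective (hmn : Nat.Coprime m n)
    (hx : ∀ j, wordOrbit a x (j * n) = x) (k : Fin m) :
    Function.Injective fun j : Fin m => particleRank a x (j * n) k := by
  intro i j hij
  have h1 := apply_particleRank (movesWith_self a x) (hx i) k
  have h2 := apply_particleRank (movesWith_self a x) (hx j) k
  simp only at hij
  rw [hij, h2] at h1
  have h3 : ((i : ℤ) - j) * n = m * (hits a x (i * n) k - hits a x (j * n) k) := by
    have : (((i : ℕ) : ℝ) - (j : ℕ)) * n = m * (hits a x (i * n) k - hits a x (j * n) k) := by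
      linarith
    exact_mod_cast this
  have h4 : (m : ℤ) ∣ (i : ℤ) - j :=
    IsCoprime.dvd_of_dvd_mul_right (Nat.isCoprime_iff_coprime.2 hmn) ⟨_, h3⟩
  have h5 : ((j : ℕ) : ℤ) ≡ (i : ℕ) [ZMOD m] := (Int.modEq_iff_dvd).2 h4
  have h6 := Int.natCast_modEq_iff.1 h5
  exact Fin.ext (h6.eq_of_lt_of_lt j.2 i.2).symm

theorem particleRank_bijective (hmn : Nat.Coprime m n)
    (hx : ∀ j, wordOrbit a x (j * n) = x) (k : Fin m) :
    Function.Bijective fun j : Fin m => particleRank a x (j * n) k :=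
  Finite.injective_iff_bijective.1 (particleRank_injective hmn hx k)

theorem hasDistinctResidues_of_fixed (hmn : Nat.Coprime m n)
    (hx : ∀ j, wordOrbit a x (j * n) = x) : HasDistinctResidues x := by
  have hrank := fun j => apply_particleRank (movesWith_self a x) (hx j)
  refine ⟨fun k l => ?_, fun k l c hc => ?_, fun k => ?_⟩
  · obtain ⟨j, rfl⟩ := (particleRank_bijective hmn hx k).2 l
    exact ⟨m * hits a x (j * n) k - j * n, by simp only [hrank]; push_cast; ring⟩
  · obtain ⟨j, rfl⟩ := (particleRank_bijective hmn hx k).2 l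
    simp only [hrank] at hc
    have h1 : ((j : ℕ) : ℤ) * n = m * (hits a x (j * n) k - c) := by
      have : ((j : ℕ) : ℝ) * n = m * (hits a x (j * n) k - c) := by linarith
      exact_mod_cast this
    have h2 : (m : ℤ) ∣ (j : ℕ) :=
      IsCoprime.dvd_of_dvd_mul_right (Nat.isCoprime_iff_coprime.2 hmn) ⟨_, h1⟩
    have h3 : (j : ℕ) = 0 := Nat.eq_zero_of_dvd_of_lt (Int.natCast_dvd_natCast.1 h2) j.2
    simp [h3, particleRank]
  · have hm : (0 : ℤ) < m := by exact_mod_cast k.pos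
    obtain ⟨u, v, huv⟩ := Nat.isCoprime_iff_coprime.2 hmn
    -- `j` is a natural number with `j * n ≡ -1` modulo `m`
    obtain ⟨j, hj⟩ := Int.eq_ofNat_of_zero_le (Int.emod_nonneg (-v) hm.ne')
    have hdiv := Int.emod_add_mul_ediv (-v) m
    refine ⟨particleRank a x (j * n) k, hits a x (j * n) k + (-v / m) * n - u, ?_⟩
    rw [hrank]
    have h1 : (j : ℤ) * n = -(1 - u * m) - m * (-v / m) * n := by
      rw [← huv, ← hj]; linear_combination (n : ℤ) * hdiv
    have h2 : (j : ℝ) * n = -(1 - u * m) - m * ((-v / m : ℤ) : ℝ) * n := by exact_mod_cast h1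
    rw [h2]; push_cast; ring

/-- A fixed point has its coordinates in the same class modulo `1` as `(m + 1) / 2`: average the
positions which one particle takes at the times `0, n, …, (m - 1) * n`. -/
theorem exists_int_of_fixed (hmn : Nat.Coprime m n)
    (hx : ∀ j, wordOrbit a x (j * n) = x) (hsum : ∑ i, x i = 0) (k : Fin m) :
    ∃ z : ℤ, ((m : ℝ) + 1) / 2 - x k = z := by
  have hm : (0 : ℝ) < m := by exact_mod_cast k.pos
  have hrank := fun j => apply_particleRank (movesWith_self a x) (hx j) k
  have h1 : ∑ j : Fin m, x (particleRank a x (j * n) k) = 0 := by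
    rw [← hsum]
    exact (particleRank_bijective hmn hx k).sum_comp x
  have h2 : ∑ j : Fin m, ((j : ℕ) : ℝ) = m * (m - 1) / 2 := by
    have h3 : (((∑ i ∈ Finset.range m, i) * 2 : ℕ) : ℝ) = ((m * (m - 1) : ℕ) : ℝ) := by
      rw [Finset.sum_range_id_mul_two]
    rw [Fin.sum_univ_eq_sum_range (fun j => (j : ℝ)) m, eq_div_iff two_ne_zero]
    rwa [Nat.cast_mul, Nat.cast_mul, Nat.cast_sub k.pos, Nat.cast_sum, Nat.cast_one,
      Nat.cast_two] at h3
  simp only [hrank] at h1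
  rw [Finset.sum_sub_distrib, Finset.sum_add_distrib, ← Finset.mul_sum, ← Finset.sum_mul, h2]
    at h1
  simp only [Finset.sum_const, Finset.card_univ, Fintype.card_fin, nsmul_eq_mul] at h1
  have h4 : x k = n * (m - 1) / 2 - ∑ j : Fin m, (hits a x (j * n) k : ℝ) := by
    refine mul_left_cancel₀ hm.ne' ?_
    linear_combination h1
  -- `m + 1 - n * (m - 1)` is even, as `m` and `n` are not both even
  obtain ⟨z, hz⟩ : (2 : ℤ) ∣ (m : ℤ) + 1 - n * (m - 1) := by
    rcases Nat.even_or_odd m with hev | ⟨r, hr⟩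
    · rcases Nat.even_or_odd n with hn | ⟨s, hs⟩
      · have := Nat.dvd_gcd hev.two_dvd hn.two_dvd
        rw [hmn.gcd_eq_one] at this
        omega
      · exact ⟨1 + s - s * m, by subst hs; push_cast; ring⟩
    · exact ⟨r + 1 - n * r, by subst hr; push_cast; ring⟩
  refine ⟨z + ∑ j : Fin m, hits a x (j * n) k, ?_⟩
  have hz' : (m : ℝ) + 1 - n * (m - 1) = 2 * z := by exact_mod_cast hz
  rw [h4]
  push_cast
  linarith

/-! ### Crossing particles -/

theorem exists_succ_not_iff {Q : ℕ → Prop} {s t : ℕ} (hs : Q s) (ht : ¬ Q t) :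
    ∃ i, ¬ (Q i ↔ Q (i + 1)) := by
  by_contra! h
  have : ∀ i, Q 0 ↔ Q i := fun i => by
    induction i with
    | zero => rfl
    | succ i ih => exact ih.trans (h i)
  exact ht ((this t).1 ((this s).2 hs))

/-- The closed cell of the affine braid arrangement cut out by the half-spaces that contain `x` in
their interior. -/
def closedCell {m : ℕ} (x : Fin m → ℝ) : Set (Fin m → ℝ) :=
  {y ∈ zeroSum m | ∀ k l (c : ℤ), x k - x l < c * m → y k - y l ≤ c * m}


/-- When two particles change their order, they are at most `m` apart; so both vectors have this
coordinate difference in the same strip between neighbouring hyperplanes. -/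
theorem exists_common_strip {k l : Fin m} {t : ℕ}
    (ht : ¬ (particleRank a x t k < particleRank a x t l ↔
      particleRank a x (t + 1) k < particleRank a x (t + 1) l)) :
    ∃ e : ℤ, ∀ y, (∀ t, Monotone (wordOrbit a y t)) → MovesWith a x y →
      e * m ≤ y l - y k ∧ y l - y k ≤ (e + 1) * m := by
  have hm : (0 : ℝ) < m := by exact_mod_cast k.pos
  by_cases h0 : particleRank a x t k < particleRank a x t l
  · have h1 : particleRank a x (t + 1) l ≤ particleRank a x (t + 1) k := by
      simpa [h0] using ht
    refine ⟨-(hits a x t l - hits a x t k), fun y hy hxy => ?_⟩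
    have h2 := hy t h0.le
    have h3 := hy (t + 1) h1
    rw [hxy, hxy] at h2 h3
    have h4 : m * ((hits a x t l : ℝ) - hits a x t k - 1) ≤
        m * (hits a x (t + 1) l - hits a x (t + 1) k) := by
      refine mul_le_mul_of_nonneg_left ?_ hm.le
      rw [hits_succ, hits_succ]; push_cast
      split_ifs <;> linarith
    push_cast
    constructor <;> linarith
  · have h1 : particleRank a x (t + 1) k < particleRank a x (t + 1) l := by
      simpa [h0] using ht
    refine ⟨-(hits a x t l - hits a x t k) - 1, fun y hy hxy => ?_⟩
    have h2 := hy t (not_lt.1 h0)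
    have h3 := hy (t + 1) h1.le
    rw [hxy, hxy] at h2 h3
    have h4 : m * ((hits a x (t + 1) l : ℝ) - hits a x (t + 1) k) ≤
        m * (hits a x t l - hits a x t k + 1) := by
      refine mul_le_mul_of_nonneg_left ?_ hm.le
      rw [hits_succ, hits_succ]; push_cast
      split_ifs <;> linarith
    push_cast
    constructor <;> linarith

theorem mem_closedCell_of_movesWith (hmn : Nat.Coprime m n)
    (hx : ∀ j, wordOrbit a x (j * n) = x) (hxm : ∀ t, Monotone (wordOrbit a x t))
    (hsum : y ∈ zeroSum m) (hym : ∀ t, Monotone (wordOrbit a y t)) (hxy : MovesWith a x y) :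
    y ∈ closedCell x := by
  refine ⟨hsum, fun l k c hc => ?_⟩
  have hm : (0 : ℝ) < m := by exact_mod_cast k.pos
  rcases eq_or_ne k l with rfl | hkl
  · simpa using hc.le
  -- each of the two particles is at some time the lowest one, hence below the other
  let b : Fin m := ⟨0, k.pos⟩
  have hb : ∀ i : Fin m, b ≤ i := fun i => Nat.zero_le _
  obtain ⟨s, hs⟩ := (particleRank_bijective hmn hx k).2 b
  obtain ⟨t, ht⟩ := (particleRank_bijective hmn hx l).2 b
  have h1 : particleRank a x (s * n) k < particleRank a x (s * n) l :=
    lt_of_le_of_ne (hs.trans_le (hb _)) ((particleRank a x _).injective.ne hkl)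
  have h2 : ¬ particleRank a x (t * n) k < particleRank a x (t * n) l :=
    not_lt.2 (ht.trans_le (hb _))
  obtain ⟨i, hi⟩ := exists_succ_not_iff
    (Q := fun t => particleRank a x t k < particleRank a x t l) h1 h2
  obtain ⟨e, he⟩ := exists_common_strip hi
  have h3 := (he x hxm (movesWith_self a x)).1
  have h4 := (he y hym hxy).2
  have h5 : e < c := by
    have : (e : ℝ) < c := lt_of_mul_lt_mul_right (h3.trans_lt hc) hm.le
    exact_mod_cast this
  have h6 : ((e : ℝ) + 1) * m ≤ c * m := by
    gcongr; exact_mod_cast h5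
  linarith

/-- The particles of such an `x` never tie, as they all move by the same amount modulo `m`. -/
theorem letterShift_injective (hres : HasDistinctResidues x) (t : ℕ) :
    Function.Injective (letterShift (a t) (wordOrbit a x t)) := by
  intro k l hkl
  obtain ⟨k, rfl⟩ := (particleRank a x t).surjective k
  obtain ⟨l, rfl⟩ := (particleRank a x t).surjective l
  rw [letterShift_particleRank (movesWith_self a x t k),
    letterShift_particleRank (movesWith_self a x t l)] at hkl
  have := hres.eq_of_sub k l (hits a x (t + 1) k - hits a x (t + 1) l) (by push_cast; linarith)
  rw [this]

theorem movesWith_of_recurrent (hres : HasDistinctResidues x)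
    (h : ∀ t, ∃ s, t < s ∧ wordOrbit a x s = x ∧ wordOrbit a y s = y) : MovesWith a x y :=
  movesWith_of_monotone fun t _ =>
    (monovary_of_recurrent h t).monotone_comp_sort (letterShift_injective hres t)

/-! ### The cell of a fixed point -/

theorem movesWith_of_mem_closedCell (hres : HasDistinctResidues x) (hy : y ∈ closedCell x) :
    MovesWith a x y := by
  refine movesWith_of_monotone fun t ih i j hij => ?_
  rcases hij.eq_or_lt with rfl | hlt
  · exact le_rfl
  have h1 := (Tuple.monotone_sort (letterShift (a t) (wordOrbit a x t))).strictMono_of_injective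
    ((letterShift_injective hres t).comp (Equiv.injective _)) hlt
  simp only [Function.comp_apply] at h1 ⊢
  generalize Tuple.sort (letterShift (a t) (wordOrbit a x t)) i = i' at *
  generalize Tuple.sort (letterShift (a t) (wordOrbit a x t)) j = j' at *
  obtain ⟨k, rfl⟩ := (particleRank a x t).surjective i'
  obtain ⟨l, rfl⟩ := (particleRank a x t).surjective j'
  rw [letterShift_particleRank (movesWith_self a x t k),
    letterShift_particleRank (movesWith_self a x t l)] at h1
  rw [letterShift_particleRank (ih k), letterShift_particleRank (ih l)]
  have := hy.2 k l (hits a x (t + 1) l - hits a x (t + 1) k) (by push_cast; linarith)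
  push_cast at this
  linarith

theorem particleRank_mul_self (hres : HasDistinctResidues x)
    (hx : ∀ j, wordOrbit a x (j * n) = x) (k : Fin m) :
    particleRank a x (m * n) k = k := by
  have := apply_particleRank (movesWith_self a x) (hx m) k
  exact (hres.eq_of_sub k _ (hits a x (m * n) k - n) (by rw [this]; push_cast; ring)).symm

/-- The points of the cell return after `m` repetitions of the word. -/
theorem wordOrbit_mul_self (hres : HasDistinctResidues x)
    (hx : ∀ j, wordOrbit a x (j * n) = x) (hxy : MovesWith a x y) :
    wordOrbit a y (m * n) = y := by
  funext k
  have h1 := apply_particleRank (movesWith_self a x) (hx m) k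
  have h2 := hxy (m * n) k
  rw [particleRank_mul_self hres hx] at h1 h2
  push_cast at h2
  linarith

/-- A vector that recurs when the fixed point does differs from it by a vector which is constant
on the orbits of the particles. -/
theorem sub_particleRank (hx : ∀ j, wordOrbit a x (j * n) = x) (hxy : MovesWith a x y) {j : ℕ}
    (hy : wordOrbit a y (j * n) = y) (k : Fin m) :
    y (particleRank a x (j * n) k) - x (particleRank a x (j * n) k) = y k - x k := by
  have h1 := apply_particleRank (movesWith_self a x) (hx j) k
  have h2 := apply_particleRank hxy hy k
  linarith

theorem eq_of_const_sub {x y : Fin m → ℝ} (hx : ∑ i, x i = 0) (hy : ∑ i, y i = 0)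
    (h : ∀ k l, y k - x k = y l - x l) : y = x := by
  funext k
  have hm : (0 : ℝ) < m := by exact_mod_cast k.pos
  have h1 : ∑ l, (y l - x l) = 0 := by rw [Finset.sum_sub_distrib, hx, hy, sub_zero]
  rw [Finset.sum_congr rfl fun l _ => h l k] at h1
  simp only [Finset.sum_const, Finset.card_univ, Fintype.card_fin, nsmul_eq_mul] at h1
  have := (mul_eq_zero.1 h1).resolve_left hm.ne'
  linarith

theorem eq_of_fixed (hmn : Nat.Coprime m n) (hx : ∀ j, wordOrbit a x (j * n) = x)
    (hxy : MovesWith a x y) (hy : ∀ j, wordOrbit a y (j * n) = y)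
    (hxs : ∑ i, x i = 0) (hys : ∑ i, y i = 0) : y = x := by
  refine eq_of_const_sub hxs hys fun k l => ?_
  obtain ⟨j, rfl⟩ := (particleRank_bijective hmn hx k).2 l
  exact (sub_particleRank hx hxy (hy j) k).symm

theorem period_of_sub_injective (hmn : Nat.Coprime m n) (hx : ∀ j, wordOrbit a x (j * n) = x)
    (hxy : MovesWith a x y) (hinj : Function.Injective (y - x)) {j : ℕ} (hj : j < m)
    (hy : wordOrbit a y (j * n) = y) : j = 0 := by
  have hm : 0 < m := by omega
  let k : Fin m := ⟨0, hm⟩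
  have h1 : particleRank a x (j * n) k = k := hinj (sub_particleRank hx hxy hy k)
  have h2 := @particleRank_injective _ _ _ _ hmn hx k ⟨j, hj⟩ ⟨0, hm⟩
    (by simpa [particleRank] using h1)
  simpa using h2

end FixedPoint

/-! ### Orbits under a parking function are bounded -/

theorem sum_sq_letterAct {m : ℕ} (a : Fin m) {y : Fin m → ℝ} (hy : ∑ i, y i = 0) :
    ∑ i, letterAct a y i ^ 2 = ∑ i, y i ^ 2 + (2 * m * y a + m * (m - 1)) := by
  have h1 : ∑ i, letterAct a y i ^ 2 = ∑ i, letterShift a y i ^ 2 :=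
    Equiv.sum_comp (Tuple.sort (letterShift a y)) fun i => letterShift a y i ^ 2
  have h2 : ∀ i, letterShift a y i ^ 2 =
      y i ^ 2 + (if i = a then 2 * m * y a + m ^ 2 - 2 * m else 0) - 2 * y i + 1 := by
    intro i
    unfold letterShift
    split_ifs with h
    · rw [h]; ring
    · ring
  rw [h1, Finset.sum_congr rfl fun i _ => h2 i]
  simp only [Finset.sum_add_distrib, Finset.sum_sub_distrib, ← Finset.mul_sum, hy]
  simp
  ring

theorem abs_letterAct_sub_le {m : ℕ} (a : Fin m) {y : Fin m → ℝ} (hy : Monotone y) (i : Fin m) :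
    |letterAct a y i - y i| ≤ m := by
  have h1 := (sqDist_sort (letterShift a y) y).1
  rw [Tuple.sort_eq_refl_iff_monotone.2 hy] at h1
  have h2 : sqDist (letterShift a y) y = m * (m - 1) := by
    have : ∀ i, (letterShift a y i - y i) ^ 2 =
        (if i = a then (m : ℝ) ^ 2 - 2 * m else 0) + 1 := by
      intro i
      unfold letterShift
      split_ifs <;> ring
    rw [sqDist, Finset.sum_congr rfl fun i _ => this i, Finset.sum_add_distrib]
    simp
    ring
  have h3 : (letterAct a y i - y i) ^ 2 ≤ sqDist (letterAct a y) y :=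
    Finset.single_le_sum (f := fun i => (letterAct a y i - y i) ^ 2)
      (fun _ _ => sq_nonneg _) (Finset.mem_univ i)
  have h4 : sqDist (letterAct a y) y ≤ m * (m - 1) := h1.trans_eq h2
  have hm : (0 : ℝ) ≤ m := Nat.cast_nonneg m
  exact abs_le_of_sq_le_sq (by nlinarith) hm

theorem abs_wordOrbit_sub_le {m : ℕ} (a : ℕ → Fin m) {x : Fin m → ℝ} (hx : x ∈ weylChamber m)
    (t : ℕ) (i : Fin m) : |wordOrbit a x t i - x i| ≤ t * m := by
  induction t with
  | zero => simp [wordOrbit]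
  | succ t ih =>
    have h1 := abs_letterAct_sub_le (a t) (wordOrbit_mem_weylChamber a hx t).2 i
    have h2 := abs_sub_le (wordOrbit a x (t + 1) i) (wordOrbit a x t i) (x i)
    change |wordOrbit a x (t + 1) i - wordOrbit a x t i| ≤ m at h1
    push_cast
    linarith

theorem sum_sq_wordOrbit_le {m n : ℕ} (a : ℕ → Fin m) {x : Fin m → ℝ} (hx : x ∈ weylChamber m)
    {t : ℕ} (ht : t ≤ n) :
    ∑ i, wordOrbit a x t i ^ 2 ≤ ∑ i, x i ^ 2 + 2 * m * ∑ s ∈ Finset.range t, x (a s) +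
      t * (2 * m * (n * m) + m * (m - 1)) := by
  induction t with
  | zero => simp [wordOrbit]
  | succ t ih =>
    have h1 := sum_sq_letterAct (a t) (wordOrbit_mem_weylChamber a hx t).1
    have h2 := (abs_le.1 (abs_wordOrbit_sub_le a hx t (a t))).2
    have h3 : (t : ℝ) * m ≤ n * m := by
      gcongr; omega
    have h4 : 2 * (m : ℝ) * wordOrbit a x t (a t) ≤ 2 * m * (x (a t) + n * m) := by
      gcongr; linarith
    have h5 := ih (by omega)
    change ∑ i, letterAct (a t) (wordOrbit a x t) i ^ 2 ≤ _
    rw [h1, Finset.sum_range_succ]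
    push_cast
    linarith

/-- For coprime `m` and `n` the parking inequalities are strict in the range `0 < i < m`. -/
theorem IsParkingFunction.add_one_le {m n : ℕ} (hmn : Nat.Coprime m n) {p : Fin n → Fin m}
    (hp : IsParkingFunction m n p) {i : ℕ} (hi : 0 < i) (him : i < m) :
    i * n + 1 ≤ m * (Finset.univ.filter fun j => (p j : ℕ) < i).card := by
  have hm : (0 : ℚ) < m := by exact_mod_cast hi.trans him
  have h1 := hp i hi him.le
  rw [div_le_iff₀ hm] at h1
  have h2 : i * n ≤ m * (Finset.univ.filter fun j => (p j : ℕ) < i).card := by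
    rw [mul_comm m]; exact_mod_cast h1
  rcases h2.lt_or_eq with h3 | h3
  · exact h3
  · have : m ∣ i := hmn.dvd_of_dvd_mul_right ⟨_, h3⟩
    exact absurd (Nat.le_of_dvd hi this) (by omega)

/-- The parking condition, summed by parts against a monotone vector with sum zero. -/
theorem IsParkingFunction.sum_le {m n : ℕ} (hmn : Nat.Coprime m n) {p : Fin n → Fin m}
    (hp : IsParkingFunction m n p) {x : Fin m → ℝ} (hx : x ∈ weylChamber m) (i j : Fin m) :
    m * ∑ s, x (p s) ≤ -(x j - x i) := by
  have hm0 : 0 < m := i.pos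
  have hm : (0 : ℝ) < m := by exact_mod_cast hm0
  let T : ℕ → ℝ := fun k => ∑ s, if (p s : ℕ) < k then x (p s) else 0
  let C : ℕ → ℝ := fun k => ∑ s, if (p s : ℕ) < k then 1 else 0
  let S : ℕ → ℝ := fun k => ∑ i : Fin m, if (i : ℕ) < k then x i else 0
  have hT : ∀ k (hk : k < m), T (k + 1) = T k + x ⟨k, hk⟩ * (C (k + 1) - C k) := by
    intro k hk
    simp only [T, C]
    rw [← Finset.sum_sub_distrib, Finset.mul_sum, ← Finset.sum_add_distrib]
    refine Finset.sum_congr rfl fun s _ => ?_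
    rcases lt_trichotomy (p s : ℕ) k with h | h | h
    · simp [h, h.trans (Nat.lt_succ_self k)]
    · have : p s = ⟨k, hk⟩ := Fin.ext h
      simp [this]
    · simp [h.not_gt, show ¬ (p s : ℕ) < k + 1 by omega]
  have hS : ∀ k (hk : k < m), S (k + 1) = S k + x ⟨k, hk⟩ := by
    intro k hk
    have : x ⟨k, hk⟩ = ∑ i : Fin m, if i = ⟨k, hk⟩ then x i else 0 := by simp
    simp only [S]
    rw [this, ← Finset.sum_add_distrib]
    refine Finset.sum_congr rfl fun s _ => ?_
    rcases lt_trichotomy (s : ℕ) k with h | h | h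
    · simp [h, h.trans (Nat.lt_succ_self k), Fin.ext_iff, h.ne]
    · have : s = ⟨k, hk⟩ := Fin.ext h
      simp [this]
    · simp [h.not_gt, show ¬ (s : ℕ) < k + 1 by omega, Fin.ext_iff, h.ne']
  have hC : ∀ k, 0 < k → k < m → k * n + 1 ≤ m * C k := by
    intro k h0 hk
    have := hp.add_one_le hmn h0 hk
    simp only [C, Finset.sum_boole]
    exact_mod_cast this
  have key : ∀ k (hk : k < m), m * T (k + 1) - n * S (k + 1) ≤
      x ⟨k, hk⟩ * (m * C (k + 1) - (k + 1) * n) - (x ⟨k, hk⟩ - x ⟨0, hm0⟩) := by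
    intro k
    induction k with
    | zero =>
      intro hk
      have h1 : T 0 = 0 := by simp [T]
      have h2 : S 0 = 0 := by simp [S]
      have h3 : C 0 = 0 := by simp [C]
      rw [hT 0 hk, hS 0 hk, h1, h2, h3]
      apply le_of_eq; push_cast; ring
    | succ k ih =>
      intro hk
      have h1 := ih (by omega)
      have h2 := hC (k + 1) (by omega) hk
      have h3 : x ⟨k, by omega⟩ ≤ x ⟨k + 1, hk⟩ := hx.2 (by simp [Fin.le_def])
      rw [hT (k + 1) hk, hS (k + 1) hk]
      push_cast at h2 ⊢
      have h4 := mul_nonneg (sub_nonneg.2 h2) (sub_nonneg.2 h3)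
      linarith
  have h1 := key (m - 1) (by omega)
  have h2 : ((m - 1 : ℕ) : ℝ) + 1 = m := by
    rw [Nat.cast_sub hm0]; simp
  rw [Nat.sub_add_cancel hm0, h2] at h1
  have h3 : T m = ∑ s, x (p s) := by simp [T]
  have h4 : S m = 0 := by simp [S, hx.1]
  have h5 : C m = n := by simp [C]
  rw [h3, h4, h5] at h1
  have h6 : x ⟨0, hm0⟩ ≤ x i := hx.2 (Nat.zero_le _)
  have h7 : x j ≤ x ⟨m - 1, by omega⟩ := hx.2 (Nat.le_sub_one_of_lt j.2)
  linarith

/-- The squared norm stays bounded: outside a large ball one pass of the parking function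
decreases it. -/
theorem IsParkingFunction.exists_bound {m n : ℕ} (hm0 : 0 < m) (hmn : Nat.Coprime m n)
    {p : Fin n → Fin m} (hp : IsParkingFunction m n p) {x : Fin m → ℝ} (hx : x ∈ weylChamber m) :
    ∃ R : ℝ, ∀ j, ∑ i, (wordAct p)^[j] x i ^ 2 ≤ R := by
  obtain ⟨a, ha⟩ := exists_isRepetition p hm0
  set C : ℝ := n * (2 * m * (n * m) + m * (m - 1)) with hC
  have hm : (1 : ℝ) ≤ m := by exact_mod_cast hm0
  have hC0 : 0 ≤ C := by
    have : (0 : ℝ) ≤ m - 1 := by linarith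
    positivity
  have step : ∀ y ∈ weylChamber m, ∑ i, wordAct p y i ^ 2 ≤
      max (∑ i, y i ^ 2) (m * C ^ 2 + C) := by
    intro y hy
    let b : Fin m := ⟨0, hm0⟩
    let e : Fin m := ⟨m - 1, by omega⟩
    have h1 := sum_sq_wordOrbit_le a hy (le_refl n)
    have h2 := hp.sum_le hmn hy b e
    have h3 : ∑ s ∈ Finset.range n, y (a s) = ∑ s, y (p s) := by
      rw [← Fin.sum_univ_eq_sum_range (fun s => y (a s)) n]
      refine Finset.sum_congr rfl fun s _ => ?_
      have := ha 0 s
      rw [zero_mul, zero_add] at this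
      rw [this]
    have h4 : wordAct p y = wordOrbit a y n := by
      simpa using ha.iterate y 1
    rw [h3, ← hC, ← h4] at h1
    have hbe : ∀ i, y b ≤ y i ∧ y i ≤ y e := fun i =>
      ⟨hy.2 (Nat.zero_le _), hy.2 (Nat.le_sub_one_of_lt i.2)⟩
    have hr : 0 ≤ y e - y b := sub_nonneg.2 (hbe b).2
    rcases le_total C (y e - y b) with h | h
    · exact le_max_of_le_left (by linarith)
    · refine le_max_of_le_right ?_
      have hb0 : y b ≤ 0 := by
        have := Finset.card_nsmul_le_sum Finset.univ y (y b) fun i _ => (hbe i).1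
        rw [hy.1] at this
        simp only [Finset.card_univ, Fintype.card_fin, nsmul_eq_mul] at this
        by_contra! h0
        nlinarith
      have he0 : 0 ≤ y e := by
        have := Finset.sum_le_card_nsmul Finset.univ y (y e) fun i _ => (hbe i).2
        rw [hy.1] at this
        simp only [Finset.card_univ, Fintype.card_fin, nsmul_eq_mul] at this
        by_contra! h0
        nlinarith
      have h5 : ∑ i, y i ^ 2 ≤ m * C ^ 2 := by
        have : ∀ i ∈ Finset.univ, y i ^ 2 ≤ C ^ 2 := fun i _ => by
          have := hbe i
          exact sq_le_sq' (by linarith) (by linarith)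
        simpa using Finset.sum_le_card_nsmul _ _ _ this
      linarith
  refine ⟨max (∑ i, x i ^ 2) (m * C ^ 2 + C), fun j => ?_⟩
  have hmem : ∀ j, (wordAct p)^[j] x ∈ weylChamber m := fun j => by
    rw [ha.iterate]; exact wordOrbit_mem_weylChamber a hx _
  induction j with
  | zero => exact le_max_left _ _
  | succ j ih =>
    rw [Function.iterate_succ_apply']
    exact (step _ (hmem j)).trans (max_le ih (le_max_right _ _))

/-! ### Every orbit is eventually periodic -/

theorem finite_int_of_sq_le {m : ℕ} (hm : 0 < m) (c R : ℝ) :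
    {v : ℝ | v ^ 2 ≤ R ∧ ∃ z : ℤ, v = c + m * z}.Finite := by
  have hm' : (0 : ℝ) < m := by exact_mod_cast hm
  refine ((Set.finite_Icc ⌈(-√R - c) / m⌉ ⌊(√R - c) / m⌋).image
    fun z : ℤ => c + m * z).subset ?_
  rintro v ⟨hv, z, rfl⟩
  have h1 := abs_le.1 (Real.abs_le_sqrt hv)
  refine ⟨z, ⟨Int.ceil_le.2 ?_, Int.le_floor.2 ?_⟩, rfl⟩
  · rw [div_le_iff₀ hm']; linarith
  · rw [le_div_iff₀ hm']; linarith

/-- Coordinates are preserved modulo `m` by `m` passes, so that a bounded orbit is finite. -/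
theorem IsParkingFunction.exists_mem_periodicPts {m n : ℕ} (hm0 : 0 < m) (hmn : Nat.Coprime m n)
    {p : Fin n → Fin m} (hp : IsParkingFunction m n p) {x : Fin m → ℝ} (hx : x ∈ weylChamber m) :
    ∃ k, (wordAct p)^[k] x ∈ Function.periodicPts (wordAct p) := by
  obtain ⟨a, ha⟩ := exists_isRepetition p hm0
  obtain ⟨R, hR⟩ := hp.exists_bound hm0 hmn hx
  let S : Set ℝ := ⋃ k, {v : ℝ | v ^ 2 ≤ R ∧ ∃ z : ℤ, v = x k + m * z}
  have hS : S.Finite := Set.finite_iUnion fun k => finite_int_of_sq_le hm0 _ _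
  have hpi : (Set.univ.pi fun _ : Fin m => S).Finite := Set.Finite.pi fun _ => hS
  have hmem : ∀ j, (wordAct p)^[j * m] x ∈ Set.univ.pi fun _ : Fin m => S := by
    intro j r _
    obtain ⟨k, hk⟩ := (particleRank a x (j * m * n)).surjective r
    refine Set.mem_iUnion.2 ⟨k, ?_, hits a x (j * m * n) k - j * n, ?_⟩
    · exact (Finset.single_le_sum (f := fun r => (wordAct p)^[j * m] x r ^ 2)
        (fun _ _ => sq_nonneg _) (Finset.mem_univ r)).trans (hR _)
    · have := movesWith_self a x (j * m * n) k
      rw [hk] at this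
      rw [ha.iterate, this]
      push_cast
      ring
  obtain ⟨i, j, hij, h⟩ := hpi.exists_lt_map_eq_of_forall_mem hmem
  refine ⟨i * m, (j - i) * m, Nat.mul_pos (by omega) hm0, ?_⟩
  rw [Function.IsPeriodicPt, Function.IsFixedPt, ← Function.iterate_add_apply, ← add_mul,
    Nat.sub_add_cancel hij.le]
  exact h.symm

/-! ### The mean of a periodic orbit is a fixed point -/

/-- The mean of finitely many vectors. -/
noncomputable def vectorMean {m N : ℕ} (u : Fin N → Fin m → ℝ) : Fin m → ℝ :=
  fun k => (∑ i, u i k) / N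

theorem vectorMean_mem_weylChamber {m N : ℕ} {u : Fin N → Fin m → ℝ}
    (h : ∀ i, u i ∈ weylChamber m) : vectorMean u ∈ weylChamber m := by
  constructor
  · simp only [vectorMean]
    rw [← Finset.sum_div, Finset.sum_comm, Finset.sum_eq_zero fun i _ => (h i).1, zero_div]
  · intro k l hkl
    simp only [vectorMean]
    gcongr with i
    exact (h i).2 hkl

theorem letterAct_vectorMean {m N : ℕ} (hN : 0 < N) (a : Fin m) {u : Fin N → Fin m → ℝ}
    (h : ∀ i j, Monovary (letterShift a (u i)) (letterShift a (u j))) :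
    letterAct a (vectorMean u) = vectorMean fun i => letterAct a (u i) := by
  have hN' : (N : ℝ) ≠ 0 := by exact_mod_cast hN.ne'
  have hshift : letterShift a (vectorMean u) = vectorMean fun i => letterShift a (u i) := by
    funext k
    simp only [letterShift, vectorMean]
    rw [Finset.sum_sub_distrib, Finset.sum_add_distrib]
    simp only [Finset.sum_const, Finset.card_univ, Fintype.card_fin, nsmul_eq_mul]
    field_simp
  have hmono := monotone_comp_sort_of_sum h
  set σ := Tuple.sort fun k => ∑ i, letterShift a (u i) k
  have h1 : letterAct a (vectorMean u) = letterShift a (vectorMean u) ∘ σ := by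
    refine comp_sort_eq σ ?_
    rw [hshift]
    intro k l hkl
    simp only [vectorMean, Function.comp_apply]
    gcongr with i
    exact hmono i hkl
  have h2 : ∀ i, letterAct a (u i) = letterShift a (u i) ∘ σ := fun i => comp_sort_eq σ (hmono i)
  rw [h1, hshift]
  simp only [h2]
  rfl

theorem exists_fixedPoint {m n : ℕ} (hm : 0 < m) (hn : 0 < n) (p : Fin n → Fin m)
    {y : Fin m → ℝ} (hy : y ∈ weylChamber m) (hper : y ∈ Function.periodicPts (wordAct p)) :
    ∃ x ∈ weylChamber m, wordAct p x = x := by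
  obtain ⟨a, ha⟩ := exists_isRepetition p hm
  obtain ⟨N, hN, hNy⟩ := hper
  let u : Fin N → Fin m → ℝ := fun i => (wordAct p)^[i] y
  have hrec : ∀ i j : Fin N, ∀ t, ∃ s, t < s ∧ wordOrbit a (u i) s = u i ∧
      wordOrbit a (u j) s = u j := by
    have h1 : ∀ (i : Fin N) t, wordOrbit a (u i) ((t + 1) * N * n) = u i := by
      intro i t
      rw [← ha.iterate]
      exact (hNy.apply_iterate i).const_mul (t + 1)
    refine fun i j t => ⟨(t + 1) * N * n, ?_, h1 i t, h1 j t⟩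
    calc t < t + 1 := t.lt_succ_self
      _ ≤ (t + 1) * N := Nat.le_mul_of_pos_right _ hN
      _ ≤ (t + 1) * N * n := Nat.le_mul_of_pos_right _ hn
  have horb : ∀ t, wordOrbit a (vectorMean u) t = vectorMean fun i => wordOrbit a (u i) t := by
    intro t
    induction t with
    | zero => rfl
    | succ t ih =>
      change letterAct (a t) (wordOrbit a (vectorMean u) t) = _
      rw [ih]
      exact letterAct_vectorMean hN (a t) fun i j => monovary_of_recurrent (hrec i j) t
  have hmem : ∀ j, (wordAct p)^[j] y ∈ weylChamber m := fun j => by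
    rw [ha.iterate]; exact wordOrbit_mem_weylChamber a hy _
  refine ⟨vectorMean u, vectorMean_mem_weylChamber fun i => hmem i, ?_⟩
  have h1 : ∀ z, wordAct p z = wordOrbit a z n := fun z => by simpa using ha.iterate z 1
  rw [h1, horb]
  funext k
  simp only [vectorMean, ← h1, u]
  have hsucc : ∀ i, wordAct p ((wordAct p)^[i] y) = (wordAct p)^[i + 1] y := fun i =>
    (Function.iterate_succ_apply' _ i y).symm
  simp only [hsucc]
  rw [Fin.sum_univ_eq_sum_range (fun i => (wordAct p)^[i + 1] y k) N,
    Fin.sum_univ_eq_sum_range (fun i => (wordAct p)^[i] y k) N]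
  congr 1
  have h2 := Finset.sum_range_succ (fun i => (wordAct p)^[i] y k) N
  rw [Finset.sum_range_succ', hNy.eq] at h2
  simpa using h2

/-! ### Alcoves -/

/-- The open cell of the affine braid arrangement cut out by the half-spaces that contain `x` in
their interior. -/
def openCell {m : ℕ} (x : Fin m → ℝ) : Set (Fin m → ℝ) :=
  {y ∈ zeroSum m | ∀ k l (c : ℤ), x k - x l < c * m → y k - y l < c * m}

theorem mem_braidComplement_iff {m : ℕ} {y : Fin m → ℝ} :
    y ∈ braidComplement m ↔
      y ∈ zeroSum m ∧ ∀ k l, k ≠ l → ∀ c : ℤ, y k - y l ≠ c * m := by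
  simp only [braidComplement, braidHyperplane, Set.mem_sdiff, Set.mem_iUnion, not_exists,
    Set.mem_ofPred_eq, not_and]
  refine and_congr_right fun hy => ⟨fun h k l hkl c hc => ?_, fun h k l hkl c _ => h k l hkl.ne c⟩
  rcases lt_or_gt_of_ne hkl with h1 | h1
  · exact h k l h1 c hy hc
  · exact h l k h1 (-c) hy (by push_cast; linarith)

theorem openCell_subset_braidComplement {m : ℕ} {x : Fin m → ℝ} (hx : x ∈ braidComplement m) :
    openCell x ⊆ braidComplement m := by
  intro y hy
  rw [mem_braidComplement_iff] at hx ⊢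
  refine ⟨hy.1, fun k l hkl c hc => ?_⟩
  rcases lt_or_gt_of_ne (hx.2 k l hkl c) with h | h
  · exact (hy.2 k l c h).ne hc
  · have := hy.2 l k (-c) (by push_cast; linarith)
    push_cast at this
    linarith

theorem combo_mem_zeroSum {m : ℕ} {x y : Fin m → ℝ} (hx : x ∈ zeroSum m) (hy : y ∈ zeroSum m)
    (s t : ℝ) : s • x + t • y ∈ zeroSum m := by
  have hx' : ∑ i, x i = 0 := hx
  have hy' : ∑ i, y i = 0 := hy
  change ∑ i, (s * x i + t * y i) = 0
  rw [Finset.sum_add_distrib, ← Finset.mul_sum, ← Finset.mul_sum, hx', hy']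
  simp

theorem combo_mem_openCell {m : ℕ} {x y z : Fin m → ℝ} (hy : y ∈ openCell x)
    (hz : z ∈ closedCell x) {s t : ℝ} (hs : 0 < s) (ht : 0 ≤ t) (hst : s + t = 1) :
    s • y + t • z ∈ openCell x := by
  refine ⟨combo_mem_zeroSum hy.1 hz.1 s t, fun k l c hc => ?_⟩
  have h1 := mul_lt_mul_of_pos_left (hy.2 k l c hc) hs
  have h2 := mul_le_mul_of_nonneg_left (hz.2 k l c hc) ht
  have h3 : (c : ℝ) * m = s * (c * m) + t * (c * m) := by rw [← add_mul, hst, one_mul]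
  simp only [Pi.add_apply, Pi.smul_apply, smul_eq_mul]
  linarith

theorem openCell_subset_closedCell {m : ℕ} (x : Fin m → ℝ) : openCell x ⊆ closedCell x :=
  fun _ hy => ⟨hy.1, fun k l c hc => (hy.2 k l c hc).le⟩

theorem convex_openCell {m : ℕ} (x : Fin m → ℝ) : Convex ℝ (openCell x) := by
  intro y hy z hz s t hs ht hst
  rcases hs.eq_or_lt with rfl | hs
  · have : t = 1 := by linarith
    simpa [this] using hz
  · exact combo_mem_openCell hy (openCell_subset_closedCell x hz) hs ht hst

theorem convex_closedCell {m : ℕ} (x : Fin m → ℝ) : Convex ℝ (closedCell x) := by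
  intro y hy z hz s t hs ht hst
  refine ⟨combo_mem_zeroSum hy.1 hz.1 s t, fun k l c hc => ?_⟩
  have h1 := mul_le_mul_of_nonneg_left (hy.2 k l c hc) hs
  have h2 := mul_le_mul_of_nonneg_left (hz.2 k l c hc) ht
  have h3 : (c : ℝ) * m = s * (c * m) + t * (c * m) := by rw [← add_mul, hst, one_mul]
  simp only [Pi.add_apply, Pi.smul_apply, smul_eq_mul]
  linarith

theorem isClosed_closedCell {m : ℕ} (x : Fin m → ℝ) : IsClosed (closedCell x) := by
  have h : closedCell x = {y : Fin m → ℝ | ∑ i, y i = 0} ∩ ⋂ (k) (l) (c : ℤ)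
      (_ : x k - x l < c * m), {y : Fin m → ℝ | y k - y l ≤ c * m} := by
    ext y; simp [closedCell, zeroSum]
  rw [h]
  refine IsClosed.inter (isClosed_eq (by fun_prop) continuous_const) ?_
  exact isClosed_iInter fun k => isClosed_iInter fun l => isClosed_iInter fun c =>
    isClosed_iInter fun _ => isClosed_le (by fun_prop) continuous_const

theorem self_mem_openCell {m : ℕ} {x : Fin m → ℝ} (hx : x ∈ zeroSum m) : x ∈ openCell x :=
  ⟨hx, fun _ _ _ h => h⟩

theorem tendsto_segment {m : ℕ} (x y : Fin m → ℝ) :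
    Filter.Tendsto (fun s : ℝ => s • x + (1 - s) • y) (𝓝[>] 0) (𝓝 y) := by
  have h : Continuous fun s : ℝ => s • x + (1 - s) • y := by fun_prop
  have := h.tendsto 0
  simp only [zero_smul, sub_zero, one_smul, zero_add] at this
  exact this.mono_left nhdsWithin_le_nhds

theorem closure_openCell {m : ℕ} {x : Fin m → ℝ} (hx : x ∈ zeroSum m) :
    closure (openCell x) = closedCell x := by
  refine (closure_minimal (openCell_subset_closedCell x) (isClosed_closedCell x)).antisymm ?_
  intro y hy
  refine mem_closure_of_tendsto (tendsto_segment x y) ?_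
  filter_upwards [Ioo_mem_nhdsGT (zero_lt_one' ℝ)] with s hs
  exact combo_mem_openCell (self_mem_openCell hx) hy hs.1 (by linarith [hs.2]) (by ring)

theorem connectedComponentIn_braidComplement {m : ℕ} {x : Fin m → ℝ}
    (hx : x ∈ braidComplement m) :
    connectedComponentIn (braidComplement m) x = openCell x := by
  have hxs := (mem_braidComplement_iff.1 hx).1
  refine Set.Subset.antisymm (fun y hy => ?_)
    ((convex_openCell x).isPreconnected.subset_connectedComponentIn (self_mem_openCell hxs)
      (openCell_subset_braidComplement hx))
  refine ⟨(mem_braidComplement_iff.1 (connectedComponentIn_subset _ _ hy)).1,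
    fun k l c hc => ?_⟩
  rcases eq_or_ne k l with rfl | hkl
  · simpa using hc
  by_contra! h
  obtain ⟨z, hz, hzc⟩ := isPreconnected_connectedComponentIn.intermediate_value
    (f := fun z : Fin m → ℝ => z k - z l) (mem_connectedComponentIn hx) hy
    (by fun_prop) ⟨hc.le, h⟩
  exact (mem_braidComplement_iff.1 (connectedComponentIn_subset _ _ hz)).2 k l hkl c hzc

theorem isAlcove_closedCell {m : ℕ} {x : Fin m → ℝ} (hx : x ∈ braidComplement m) :
    IsAlcove m (closedCell x) :=
  ⟨x, hx, by rw [connectedComponentIn_braidComplement hx,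
    closure_openCell (mem_braidComplement_iff.1 hx).1]⟩

/-- A point off the hyperplanes lies in only one alcove. -/
theorem IsAlcove.eq_closedCell {m : ℕ} {B : Set (Fin m → ℝ)} (hB : IsAlcove m B)
    {x : Fin m → ℝ} (hx : x ∈ braidComplement m) (hxB : x ∈ B) : B = closedCell x := by
  obtain ⟨z, hz, rfl⟩ := hB
  have hx' := mem_braidComplement_iff.1 hx
  rw [connectedComponentIn_braidComplement hz,
    closure_openCell (mem_braidComplement_iff.1 hz).1] at hxB
  have hxz : x ∈ openCell z := by
    refine ⟨hx'.1, fun k l c hc => ?_⟩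
    rcases eq_or_ne k l with rfl | hkl
    · simpa using hc
    · exact lt_of_le_of_ne (hxB.2 k l c hc) (hx'.2 k l hkl c)
  rw [← connectedComponentIn_braidComplement hz] at hxz
  rw [connectedComponentIn_eq hxz, connectedComponentIn_braidComplement hx,
    closure_openCell hx'.1]

/-! ### Centroids -/

namespace HasDistinctResidues

variable {m : ℕ} {x : Fin m → ℝ}

theorem mem_braidComplement (hres : HasDistinctResidues x) (hx : x ∈ zeroSum m) :
    x ∈ braidComplement m :=
  mem_braidComplement_iff.2 ⟨hx, fun k l hkl c hc => hkl.symm (hres.eq_of_sub l k c hc)⟩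

theorem add_one_le (hres : HasDistinctResidues x) {k l : Fin m} {c : ℤ}
    (h : x k - x l < c * m) : x k - x l + 1 ≤ c * m := by
  obtain ⟨z, hz⟩ := hres.exists_int l k
  rw [hz] at h ⊢
  have h1 : z < c * m := by exact_mod_cast h
  have h2 : z + 1 ≤ c * m := h1
  exact_mod_cast h2

theorem closedCell_mem_nhdsWithin (hres : HasDistinctResidues x) :
    closedCell x ∈ 𝓝[zeroSum m] x := by
  rw [Metric.mem_nhdsWithin_iff]
  refine ⟨1 / 2, by norm_num, fun y hy => ⟨hy.2, fun k l c hc => ?_⟩⟩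
  have h1 : ∀ i, |y i - x i| < 1 / 2 := fun i =>
    (dist_le_pi_dist y x i).trans_lt (Metric.mem_ball.1 hy.1)
  have h2 := hres.add_one_le hc
  have h3 := abs_lt.1 (h1 k)
  have h4 := abs_lt.1 (h1 l)
  linarith

theorem strict_of_mem_nhdsWithin {y : Fin m → ℝ} (hy : y ∈ zeroSum m)
    (h : closedCell x ∈ 𝓝[zeroSum m] y) {k l : Fin m} {c : ℤ} (hc : x k - x l < c * m) :
    y k - y l < c * m := by
  rcases eq_or_ne k l with rfl | hkl
  · simpa using hc
  -- a short step in the direction `e_k - e_l` stays inside the cell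
  let z : ℝ → Fin m → ℝ := fun s => y + s • (Pi.single k 1 - Pi.single l 1)
  have hz : ∀ s, z s ∈ zeroSum m := fun s => by
    have hy' : ∑ i, y i = 0 := hy
    change ∑ i, (y i + s * ((Pi.single k 1 : Fin m → ℝ) i - (Pi.single l 1 : Fin m → ℝ) i)) = 0
    rw [Finset.sum_add_distrib, ← Finset.mul_sum, Finset.sum_sub_distrib, hy']
    simp
  have hcont : Continuous z := by fun_prop
  have ht : Filter.Tendsto z (𝓝[>] 0) (𝓝[zeroSum m] y) := by
    refine tendsto_nhdsWithin_iff.2 ⟨?_, Filter.Eventually.of_forall hz⟩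
    have := hcont.tendsto 0
    simp only [z, zero_smul, add_zero] at this
    exact this.mono_left nhdsWithin_le_nhds
  obtain ⟨s, hs, hs0⟩ := ((ht.eventually_mem h).and self_mem_nhdsWithin).exists
  have h1 := hs.2 k l c hc
  have hs0' : 0 < s := hs0
  simp [z, hkl, hkl.symm] at h1
  linarith

/-- In an alcove, the positions `x_l + c m` list the integers (up to a shift) in an order that is
the same for all its interior points, so another such point is at least as spread out. -/
theorem add_nat_le (hres : HasDistinctResidues x) {y : Fin m → ℝ}
    (hint : ∀ k l, ∃ z : ℤ, y l - y k = z)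
    (hlt : ∀ k l (c : ℤ), x k - x l < c * m → y k - y l < c * m) (j : ℕ) :
    ∀ k l (c : ℤ), x l + c * m = x k + j → y k + j ≤ y l + c * m := by
  induction j with
  | zero =>
    intro k l c h
    have hkl := hres.eq_of_sub k l (-c) (by push_cast at h ⊢; linarith)
    subst hkl
    have : (c : ℝ) * m = 0 := by push_cast at h; linarith
    simp [this]
  | succ j ih =>
    intro k l c h
    obtain ⟨i, d, hi⟩ := hres.exists_succ k
    have h1 := ih i l (c + d) (by push_cast at h ⊢; linarith)
    have h2 := hlt k i (-d) (by push_cast; linarith)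
    obtain ⟨z, hz⟩ := hint i k
    rw [hz] at h2
    have h3 : z + 1 ≤ -d * m := by
      have : z < -d * m := by exact_mod_cast h2
      exact this
    have h4 : (z : ℝ) + 1 ≤ -d * m := by exact_mod_cast h3
    push_cast at h1 ⊢
    linarith

theorem isAlcoveCentroid (hres : HasDistinctResidues x) (hx : x ∈ zeroSum m)
    (hint : ∀ i, ∃ z : ℤ, ((m : ℝ) + 1) / 2 - x i = z) :
    IsAlcoveCentroid m (closedCell x) x := by
  refine ⟨⟨hx, hres.closedCell_mem_nhdsWithin, hint⟩, fun y hy => ?_⟩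
  obtain ⟨hys, hnhds, hyint⟩ := hy
  have hle : ∀ k l, x l - x k ≤ y l - y k := by
    intro k l
    have hm : (1 : ℤ) ≤ m := by exact_mod_cast k.pos
    obtain ⟨z, hz⟩ := hres.exists_int k l
    have h0 : 0 ≤ z + |z| * m := by
      have := mul_le_mul_of_nonneg_left hm (abs_nonneg z)
      linarith [neg_abs_le z]
    obtain ⟨j, hj⟩ := Int.eq_ofNat_of_zero_le h0
    have hj' : (z : ℝ) + (|z| : ℤ) * m = j := by exact_mod_cast hj
    have := hres.add_nat_le (y := y) (fun k l => ?_)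
      (fun k l c hc => strict_of_mem_nhdsWithin hys hnhds hc) j k l |z| (by linarith)
    · linarith
    · obtain ⟨u, hu⟩ := hyint k
      obtain ⟨v, hv⟩ := hyint l
      exact ⟨u - v, by push_cast; linarith⟩
  exact eq_of_const_sub hx hys fun k l => by linarith [hle k l, hle l k]

/-- Off finitely many hyperplanes through `x`, the coordinates of `y - x` are distinct. -/
theorem closedCell_subset_closure (hres : HasDistinctResidues x) (hx : x ∈ zeroSum m) :
    closedCell x ⊆ closure {y ∈ closedCell x | Function.Injective (y - x)} := by
  intro y hy
  let μ : ℝ := (∑ i : Fin m, ((i : ℕ) : ℝ)) / m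
  -- a point of the cell whose difference from `x` has distinct coordinates
  let w : Fin m → ℝ := fun i => x i + ((i : ℕ) - μ) / m
  have hw : w ∈ closedCell x := by
    constructor
    · have hx' : ∑ i, x i = 0 := hx
      change ∑ i, (x i + ((i : ℕ) - μ) / m) = 0
      rw [Finset.sum_add_distrib, hx', ← Finset.sum_div, Finset.sum_sub_distrib]
      rcases Nat.eq_zero_or_pos m with rfl | hm
      · simp
      · have : (m : ℝ) ≠ 0 := by exact_mod_cast hm.ne'
        simp only [Finset.sum_const, Finset.card_univ, Fintype.card_fin, nsmul_eq_mul, μ]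
        field_simp
        ring
    · intro k l c hc
      have h1 := hres.add_one_le hc
      have hm : (0 : ℝ) < m := by exact_mod_cast k.pos
      have h2 : ((k : ℕ) : ℝ) ≤ m := by exact_mod_cast k.2.le
      have h3 : (((k : ℕ) : ℝ) - (l : ℕ)) / m ≤ 1 := by
        rw [div_le_one hm]
        linarith [Nat.cast_nonneg (α := ℝ) (l : ℕ)]
      have h4 : w k - w l = x k - x l + (((k : ℕ) : ℝ) - (l : ℕ)) / m := by
        simp only [w]; ring
      linarith
  refine mem_closure_of_tendsto (tendsto_segment w y) ?_
  have hinj : ∀ k l : Fin m, ∀ᶠ s in 𝓝[>] (0 : ℝ), k ≠ l →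
      (s • w + (1 - s) • y - x) k ≠ (s • w + (1 - s) • y - x) l := by
    intro k l
    rcases eq_or_ne k l with rfl | hkl
    · exact Filter.Eventually.of_forall fun s h => absurd rfl h
    by_cases h0 : (y - x) k = (y - x) l
    · filter_upwards [self_mem_nhdsWithin] with s hs _ h
      have hs' : s ≠ 0 := ne_of_gt hs
      have hm : (m : ℝ) ≠ 0 := by exact_mod_cast k.pos.ne'
      simp only [Pi.sub_apply, Pi.add_apply, Pi.smul_apply, smul_eq_mul, w] at h h0
      have h1 : s * ((((k : ℕ) : ℝ) - (l : ℕ)) / m) = 0 := by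
        linear_combination h - (1 - s) * h0
      have h2 : ((k : ℕ) : ℝ) = (l : ℕ) := by
        have := (div_eq_zero_iff.1 ((mul_eq_zero.1 h1).resolve_left hs')).resolve_right hm
        linarith
      exact hkl (Fin.ext (by exact_mod_cast h2))
    · have ht : ∀ i, Filter.Tendsto (fun s : ℝ => (s • w + (1 - s) • y - x) i) (𝓝[>] 0)
          (𝓝 ((y - x) i)) := fun i =>
        (tendsto_pi_nhds.1 (tendsto_segment w y) i).sub_const (x i)
      filter_upwards [((ht k).sub (ht l)).eventually_ne (sub_ne_zero.2 h0)] with s hs _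
      exact sub_ne_zero.1 hs
  have hall := Filter.eventually_all.2 fun k => Filter.eventually_all.2 fun l => hinj k l
  filter_upwards [Ioo_mem_nhdsGT (zero_lt_one' ℝ), hall] with s hs hs'
  refine ⟨convex_closedCell x hw hy hs.1.le (by linarith [hs.2]) (by ring), fun k l h => ?_⟩
  by_contra hkl
  exact hs' k l hkl h

theorem closedCell_subset_weylChamber (hres : HasDistinctResidues x) (hx : x ∈ weylChamber m) :
    closedCell x ⊆ weylChamber m := by
  refine fun y hy => ⟨hy.1, fun k l hkl => ?_⟩
  rcases hkl.eq_or_lt with rfl | hlt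
  · exact le_rfl
  have h1 := hx.2.strictMono_of_injective hres.injective hlt
  have := hy.2 k l 0 (by simpa using h1)
  simpa using this

end HasDistinctResidues

/-! ### Fixed and periodic points of a parking function -/

theorem subsingleton_zeroSum_one {x y : Fin 1 → ℝ} (hx : x ∈ zeroSum 1) (hy : y ∈ zeroSum 1) :
    x = y := by
  have hx' : ∑ i, x i = 0 := hx
  have hy' : ∑ i, y i = 0 := hy
  rw [Fin.sum_univ_one] at hx' hy'
  funext i
  rw [Subsingleton.elim i 0, hx', hy']

theorem IsParkingFunction.exists_fixedPoint {m n : ℕ} (hm : 0 < m) (hmn : Nat.Coprime m n)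
    {p : Fin n → Fin m} (hp : IsParkingFunction m n p) :
    ∃ x ∈ weylChamber m, wordAct p x = x := by
  have h0 : (0 : Fin m → ℝ) ∈ weylChamber m := ⟨by simp, monotone_const⟩
  rcases Nat.eq_zero_or_pos n with rfl | hn
  · exact ⟨0, h0, by simp [wordAct]⟩
  · obtain ⟨k, hk⟩ := hp.exists_mem_periodicPts hm hmn h0
    obtain ⟨a, ha⟩ := exists_isRepetition p hm
    refine _root_.exists_fixedPoint hm hn p ?_ hk
    rw [ha.iterate]
    exact wordOrbit_mem_weylChamber a h0 _

theorem mem_closedCell_of_mem_periodicPts {m n : ℕ} (hmn : Nat.Coprime m n) {p : Fin n → Fin m}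
    {a : ℕ → Fin m} (ha : IsRepetition p a) {x y : Fin m → ℝ} (hx : x ∈ weylChamber m)
    (hfix : ∀ j, wordOrbit a x (j * n) = x) (hy : y ∈ weylChamber m)
    (hper : y ∈ Function.periodicPts (wordAct p)) : y ∈ closedCell x := by
  rcases Nat.eq_zero_or_pos n with rfl | hn
  · obtain rfl : m = 1 := by simpa using hmn
    rw [subsingleton_zeroSum_one hy.1 hx.1]
    exact openCell_subset_closedCell x (self_mem_openCell hx.1)
  obtain ⟨N, hN, hNy⟩ := hper
  have hrec : ∀ t, ∃ s, t < s ∧ wordOrbit a x s = x ∧ wordOrbit a y s = y := by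
    refine fun t => ⟨(t + 1) * N * n, ?_, hfix _, ?_⟩
    · calc t < t + 1 := t.lt_succ_self
        _ ≤ (t + 1) * N := Nat.le_mul_of_pos_right _ hN
        _ ≤ (t + 1) * N * n := Nat.le_mul_of_pos_right _ hn
    · rw [← ha.iterate]
      exact hNy.const_mul (t + 1)
  exact mem_closedCell_of_movesWith hmn hfix (fun t => (wordOrbit_mem_weylChamber a hx t).2) hy.1
    (fun t => (wordOrbit_mem_weylChamber a hy t).2)
    (movesWith_of_recurrent (hasDistinctResidues_of_fixed hmn hfix) hrec)

theorem theorem1p3 (m n : ℕ) (hmn : Nat.Coprime m n) (p : Fin n → Fin m)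
    (hp : IsParkingFunction m n p) :
    ∃ xp ∈ weylChamber m, ∃ A : Set (Fin m → ℝ),
      -- `xp` is the fixed point of `p` in the Weyl chamber
      wordAct p xp = xp ∧
      (∀ x ∈ weylChamber m, wordAct p x = x → x = xp) ∧
      -- `A` is the alcove containing `xp`, and `xp` is its centroid
      IsAlcove m A ∧ xp ∈ A ∧ (∀ B, IsAlcove m B → xp ∈ B → B = A) ∧
      IsAlcoveCentroid m A xp ∧
      -- the periodic points that are not fixed are exactly the points of `A` other than `xp`
      {x ∈ weylChamber m | x ∈ Function.periodicPts (wordAct p) ∧ wordAct p x ≠ x} = A \ {xp} ∧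
      -- all of them have period `m`, and this is the least period on a dense subset of `A`
      (∀ x ∈ A \ {xp}, Function.IsPeriodicPt (wordAct p) m x) ∧
      A ⊆ closure {x ∈ A | Function.minimalPeriod (wordAct p) x = m} ∧
      -- every orbit eventually becomes periodic, with period dividing `m`
      (∀ x ∈ weylChamber m, ∃ k : ℕ,
        (wordAct p)^[k] x ∈ Function.periodicPts (wordAct p) ∧
        Function.minimalPeriod (wordAct p) ((wordAct p)^[k] x) ∣ m ∧
        (wordAct p)^[k + m] x = (wordAct p)^[k] x) := by
  have hm : 0 < m := by
    rcases Nat.eq_zero_or_pos m with rfl | h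
    · obtain rfl : n = 1 := by simpa using hmn
      exact (p 0).elim0
    · exact h
  obtain ⟨a, ha⟩ := exists_isRepetition p hm
  obtain ⟨x, hxV, hx⟩ := hp.exists_fixedPoint hm hmn
  have hfix : ∀ j, wordOrbit a x (j * n) = x := fun j => by
    rw [← ha.iterate]; exact Function.iterate_fixed hx j
  have hres := hasDistinctResidues_of_fixed hmn hfix
  have hxc := hres.mem_braidComplement hxV.1
  have hxA : x ∈ closedCell x := openCell_subset_closedCell x (self_mem_openCell hxV.1)
  have hAV := hres.closedCell_subset_weylChamber hxV
  have hmove : ∀ y ∈ closedCell x, MovesWith a x y := fun y hy =>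
    movesWith_of_mem_closedCell hres hy
  have hperiod : ∀ y ∈ closedCell x, Function.IsPeriodicPt (wordAct p) m y := fun y hy => by
    rw [Function.IsPeriodicPt, Function.IsFixedPt, ha.iterate]
    exact wordOrbit_mul_self hres hfix (hmove y hy)
  have hmem : ∀ y ∈ weylChamber m, y ∈ Function.periodicPts (wordAct p) → y ∈ closedCell x :=
    fun y hy hper => mem_closedCell_of_mem_periodicPts hmn ha hxV hfix hy hper
  have huniq : ∀ y ∈ weylChamber m, wordAct p y = y → y = x := fun y hy hyfix => by
    have hyA := hmem y hy ⟨1, one_pos, hyfix⟩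
    refine eq_of_fixed hmn hfix (hmove y hyA) (fun j => ?_) hxV.1 hy.1
    rw [← ha.iterate]; exact Function.iterate_fixed hyfix j
  refine ⟨x, hxV, closedCell x, hx, huniq, isAlcove_closedCell hxc, hxA,
    fun B hB hxB => hB.eq_closedCell hxc hxB,
    hres.isAlcoveCentroid hxV.1 (exists_int_of_fixed hmn hfix hxV.1), ?_,
    fun y hy => hperiod y hy.1, ?_, fun y hy => ?_⟩
  · ext y
    constructor
    · rintro ⟨hy, hper, hne⟩
      exact ⟨hmem y hy hper, fun h => hne (by rw [Set.mem_singleton_iff.1 h, hx])⟩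
    · rintro ⟨hy, hne⟩
      exact ⟨hAV hy, ⟨m, hm, hperiod y hy⟩, fun h => hne (huniq y (hAV hy) h)⟩
  · refine (hres.closedCell_subset_closure hxV.1).trans (closure_mono ?_)
    rintro y ⟨hy, hinj⟩
    refine ⟨hy, ?_⟩
    have hle := (hperiod y hy).minimalPeriod_le hm
    have hpos := (hperiod y hy).minimalPeriod_pos hm
    by_contra hne
    refine hpos.ne' (period_of_sub_injective hmn hfix (hmove y hy) hinj
      (lt_of_le_of_ne hle hne) ?_)
    rw [← ha.iterate]
    exact Function.isPeriodicPt_minimalPeriod (wordAct p) y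
  · obtain ⟨k, hk⟩ := hp.exists_mem_periodicPts hm hmn hy
    have hkV : (wordAct p)^[k] y ∈ weylChamber m := by
      rw [ha.iterate]; exact wordOrbit_mem_weylChamber a hy _
    have hP := hperiod _ (hmem _ hkV hk)
    refine ⟨k, hk, hP.minimalPeriod_dvd, ?_⟩
    rw [add_comm, Function.iterate_add_apply]
    exact hP
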